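/- Let $K\ge 2$ and let a quantum error-correcting code be given by an isometry $V:\mathbb C^K\to\mathbb C^N$, with code-space projection $P=VV^\dagger$, together with a complex linear space $\mathcal E$ of operators on $\mathbb C^N$ (the correctable errors) that contains the identity, is closed under adjoints, and is corrected by the code: there is a quantum channel $\mathcal R$ such that for every $E\in\mathcal E$ there is a constant $c_E$ with $\mathcal R(E\,V\rho V^\dagger E^\dagger)=c_E\,V\rho V^\dagger$ for all $\rho$. Let $\epsilon=\mathcal E\cap\mathfrak u(N)$ be the space of skew-Hermitian correctable errors, and let $\mathfrak L(\epsilon)$ be the real Lie algebra generated by $\epsilon$ inside the physical algebra $\mathfrak u(N)$ of skew-Hermitian matrices. Let $L=\{U\in U(N): PUP=UP\}$ be the group of unitary logical operators. Let $F\subseteq U(N)$ be the set of unitary fault-tolerant operators: the unitaries $W_s=F_s\cdots F_1$, $s\ge 0$, implemented by a process $\mathrm{EC}_s\,F_s\cdots \mathrm{EC}_1\,F_1$ in which every gate satisfies $F_r\in\exp(\epsilon)$ and every intermediate error correction step $\mathrm{EC}_r$ is a quantum channel that, with $W_r=F_r\cdots F_1$, restores the states of the intermediate code $W_rV$ from the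 errors $W_rEW_r^\dagger$, $E\in\mathcal E$ (that is, from the correctable errors carried through the gates already applied), up to a constant factor depending only on the error. Then the set $L_F=F\cap L$ of logical fault-tolerant operators is universal, i.e. dense in $L$, if and only if the universality condition $\mathfrak L(\epsilon)=\mathfrak u(N)$ holds. -/

import Mathlib

open scoped Matrix

attribute [local instance 100] LieRing.ofAssociativeRing

noncomputable section

namespace QEC

/-- Operators on the `n`-dimensional Hilbert space `ℂⁿ`. -/
abbrev Op (n : ℕ) : Type := Matrix (Fin n) (Fin n) ℂ

/-- The unitary group `U(n)`, with its usual topology. -/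
abbrev U (n : ℕ) : Type := Matrix.unitaryGroup (Fin n) ℂ

/-- A quantum channel (completely positive trace-preserving linear map), in Kraus form. -/
def IsChannel {n : ℕ} (Φ : Op n →ₗ[ℂ] Op n) : Prop :=
  ∃ (m : ℕ) (A : Fin m → Op n),
    ∑ k, (A k)ᴴ * A k = 1 ∧ ∀ ρ, Φ ρ = ∑ k, A k * ρ * (A k)ᴴ

/-- The unitary channel `ρ ↦ W ρ W†`. -/
def conjMap {n : ℕ} (W : Op n) : Op n →ₗ[ℂ] Op n :=
  (LinearMap.mulRight ℂ Wᴴ).comp (LinearMap.mulLeft ℂ W)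

/-- `Φ` is a recovery operation for the code with encoding `V` against the errors in `S`: it is a
channel which sends every encoded state, corrupted by an error of `S`, back to that encoded state
(up to the probability weight of the error, which does not depend on the state). -/
def IsRecovery {N K : ℕ} (V : Matrix (Fin N) (Fin K) ℂ) (S : Set (Op N))
    (Φ : Op N →ₗ[ℂ] Op N) : Prop :=
  IsChannel Φ ∧
    ∀ E ∈ S, ∃ c : ℂ, ∀ ρ : Op K, Φ (E * (V * ρ * Vᴴ) * Eᴴ) = c • (V * ρ * Vᴴ)

/-- A quantum error-correcting code: an isometric encoding `ℂᴷ → ℂᴺ` together with the space of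
errors it corrects, which is a linear space of operators containing the identity ("no error"),
closed under adjoints, and which admits a recovery operation. -/
structure Code (N K : ℕ) where
  enc : Matrix (Fin N) (Fin K) ℂ
  isometry : encᴴ * enc = 1
  errors : Submodule ℂ (Op N)
  one_mem : (1 : Op N) ∈ errors
  adjoint_mem : ∀ E ∈ errors, Eᴴ ∈ errors
  correctable : ∃ R, IsRecovery enc (errors : Set (Op N)) R

/-- The physical algebra `𝔲(N)`: the real Lie algebra of skew-Hermitian matrices. -/
def physicalAlgebra (N : ℕ) : LieSubalgebra ℝ (Op N) where
  carrier := {A | Aᴴ = -A}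
  add_mem' := by
    intro a b (ha : aᴴ = -a) (hb : bᴴ = -b)
    change (a + b)ᴴ = -(a + b)
    rw [Matrix.conjTranspose_add, ha, hb, neg_add]
  zero_mem' := by
    change (0 : Op N)ᴴ = -0
    simp
  smul_mem' := by
    intro c a (ha : aᴴ = -a)
    change (c • a)ᴴ = -(c • a)
    rw [Matrix.conjTranspose_smul, ha, star_trivial, smul_neg]
  lie_mem' := by
    intro a b (ha : aᴴ = -a) (hb : bᴴ = -b)
    change ⁅a, b⁆ᴴ = -⁅a, b⁆
    rw [Ring.lie_def, Matrix.conjTranspose_sub, Matrix.conjTranspose_mul,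
      Matrix.conjTranspose_mul, ha, hb]
    noncomm_ring

namespace Code

variable {N K : ℕ}

/-- The space `ε ⊆ 𝔲(N)` of correctable errors: the skew-Hermitian ones. -/
def gens (C : Code N K) : Set (Op N) := {X | X ∈ C.errors ∧ X ∈ physicalAlgebra N}

/-- The real Lie algebra generated by the correctable errors. -/
def errorAlgebra (C : Code N K) : LieSubalgebra ℝ (Op N) :=
  LieSubalgebra.lieSpan ℝ (Op N) C.gens

/-- The Lie algebra generated by the correctable errors is the physical algebra. -/
def UniversalityCondition (C : Code N K) : Prop := C.errorAlgebra = physicalAlgebra N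

/-- The orthogonal projection of `ℂᴺ` onto the code space. -/
def proj (C : Code N K) : Op N := C.enc * C.encᴴ

/-- The unitary logical operators: the physical unitaries which preserve the code space. -/
def logical (C : Code N K) : Set (U N) :=
  {L | C.proj * (L : Op N) * C.proj = (L : Op N) * C.proj}

/-- `Φ` is an intermediate error correction step after the gates with product `W` have been applied:
a recovery operation for the intermediate code `W(code)`, with encoding `W V`, against the
correctable errors `E` carried through these gates, i.e. against the operators `W E W†`. -/
def IsECStep (C : Code N K) (W : U N) (Φ : Op N →ₗ[ℂ] Op N) : Prop :=
  IsRecovery ((W : Op N) * C.enc)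
    {E' | ∃ E ∈ C.errors, E' = (W : Op N) * E * (W : Op N)ᴴ} Φ

/-- `IsFTRun C W Φ`: there are gates `F₁, …, Fₛ ∈ exp(ε)` and intermediate error correction steps
`EC₁, …, ECₛ` such that `Φ` is the process `ECₛ ∘ Fₛ ∘ ⋯ ∘ EC₁ ∘ F₁` and `W = Fₛ ⋯ F₁` is the
unitary operator which it implements. -/
inductive IsFTRun (C : Code N K) : U N → (Op N →ₗ[ℂ] Op N) → Prop
  | nil : IsFTRun C 1 LinearMap.id
  | step (W : U N) (Φ : Op N →ₗ[ℂ] Op N) (F : U N) (X : Op N) (EC : Op N →ₗ[ℂ] Op N) :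
      IsFTRun C W Φ → X ∈ C.gens → (F : Op N) = NormedSpace.exp X → IsECStep C (F * W) EC →
      IsFTRun C (F * W) (EC ∘ₗ conjMap (F : Op N) ∘ₗ Φ)

/-- The unitary fault-tolerant operators. -/
def faultTolerant (C : Code N K) : Set (U N) := {W | ∃ Φ, IsFTRun C W Φ}

/-- The logical fault-tolerant operators are dense in the group of unitary logical operators. -/
def FTUniversal (C : Code N K) : Prop :=
  C.logical ⊆ closure (C.faultTolerant ∩ C.logical)

end Code

end QEC

end

/-! Conjugating the given recovery by `W` gives a recovery for the intermediate code, so error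
correction never restricts the gates: the fault-tolerant operators are the group G generated by
exp(ε).

If 𝔏(ε) = 𝔲(N), the real span of the conjugates gXg⁻¹ (g ∈ G, X ∈ ε) is stable under ad ε, hence
contains 𝔏(ε) and so all of 𝔲(N). The one-parameter groups of these conjugates lie in G, and their
products fill a neighbourhood of 1 in U(N); taking roots of exponentials gives G = U(N)
(`faultTolerantGroup_eq_top`).

Conversely, 𝔏(ε) is stable under conjugation by G, hence by L when L_F is dense in L.
Differentiating and complexifying, its complex span D is stable under ad H for every H commuting
with P. If some error in ε has a nonzero off-diagonal block, D contains both off-diagonal corners,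
whose brackets together with the identity give every matrix (`eq_top_of_corners`). If none has,
Knill–Laflamme makes G act on the code space by scalars, and for K ≥ 2 a logical reflection is not a
limit of such operators. -/

noncomputable section

/-! ### Conjugation by exponentials versus commutators. -/

section BanachAlgebra

open NormedSpace Filter Topology

variable {A : Type*} [NormedRing A] [NormedAlgebra ℝ A] [CompleteSpace A]

/-- Infinitesimal invariance of a closed subspace under `ad h` gives invariance under
conjugation by `exp h`. -/
theorem Submodule.exp_mul_mul_exp_neg_mem {S : Submodule ℝ A} (hS : IsClosed (S : Set A)) {h : A}
    (had : ∀ x ∈ S, h * x - x * h ∈ S) {x : A} (hx : x ∈ S) :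
    exp h * x * exp (-h) ∈ S := by
  let _ : NormedAlgebra ℚ A := NormedAlgebra.restrictScalars ℚ ℝ A
  -- Left multiplication by h and right multiplication by -h commute and add up to ad h, so exp(ad
  -- h) x = exp(h) x exp(-h); the partial sums of the series for exp(ad h) x stay in S.
  let _ : NormedAlgebra ℚ (A →L[ℝ] A) := NormedAlgebra.restrictScalars ℚ ℝ _
  set l : A →L[ℝ] A := ContinuousLinearMap.mul ℝ A h with hl
  set r : A →L[ℝ] A := (ContinuousLinearMap.mul ℝ A).flip (-h) with hr
  have happly : ∀ (f : A →L[ℝ] A) (y : A),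
      HasSum (fun n : ℕ => ((n.factorial : ℝ)⁻¹) • (f ^ n) y) (exp f y) := fun f y => by
    simpa using (exp_series_hasSum_exp' (𝕂 := ℝ) f).mapL (ContinuousLinearMap.apply ℝ A y)
  have hlpow : ∀ (n : ℕ) (y : A), (l ^ n) y = h ^ n * y := by
    intro n
    induction n with
    | zero => simp
    | succ n ih =>
      intro y
      rw [pow_succ, mul_apply_eq_comp, ih]
      simp [hl, pow_succ, mul_assoc]
  have hrpow : ∀ (n : ℕ) (y : A), (r ^ n) y = y * (-h) ^ n := by
    intro n
    induction n with
    | zero => simp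
    | succ n ih =>
      intro y
      rw [pow_succ, mul_apply_eq_comp, ih, ContinuousLinearMap.flip_apply,
        ContinuousLinearMap.mul_apply', pow_succ', mul_assoc]
  have hexpl : ∀ y, exp l y = exp h * y := fun y => by
    have h1 := happly l y
    simp only [hlpow] at h1
    have h2 := (exp_series_hasSum_exp' (𝕂 := ℝ) h).mul_right y
    simp only [smul_mul_assoc] at h2
    exact h1.unique h2
  have hexpr : ∀ y, exp r y = y * exp (-h) := fun y => by
    have h1 := happly r y
    simp only [hrpow] at h1
    have h2 := (exp_series_hasSum_exp' (𝕂 := ℝ) (-h)).mul_left y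
    simp only [mul_smul_comm] at h2
    exact h1.unique h2
  have hcomm : Commute l r := by
    ext y; simp [hl, hr, mul_assoc]
  have hkey : exp (l + r) x = exp h * x * exp (-h) := by
    rw [exp_add_of_commute hcomm, mul_apply_eq_comp, hexpr, hexpl, mul_assoc]
  have hpow : ∀ n : ℕ, ((l + r) ^ n) x ∈ S := by
    intro n
    induction n with
    | zero => simpa
    | succ n ih =>
      rw [pow_succ', mul_apply_eq_comp]
      have := had _ ih
      simpa [hl, hr, sub_eq_add_neg] using this
  rw [← hkey]
  refine hS.mem_of_tendsto (happly (l + r) x) (Eventually.of_forall fun s => ?_)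
  exact S.sum_mem fun n _ => S.smul_mem _ (hpow n)

/-- Invariance of a closed subspace under conjugation by a one-parameter group gives
infinitesimal invariance. -/
theorem Submodule.mul_sub_mul_mem_of_exp {S : Submodule ℝ A} (hS : IsClosed (S : Set A)) {h x : A}
    (hconj : ∀ t : ℝ, exp (t • h) * x * exp (-(t • h)) ∈ S) : h * x - x * h ∈ S := by
  let _ : NormedAlgebra ℚ A := NormedAlgebra.restrictScalars ℚ ℝ A
  have h1 : HasDerivAt (fun t : ℝ => exp (t • h)) h 0 := by
    simpa using hasDerivAt_exp_smul_const (𝕂 := ℝ) h (0 : ℝ)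
  have h2 : HasDerivAt (fun t : ℝ => exp (-(t • h))) (-h) 0 := by
    simpa using hasDerivAt_exp_smul_const (𝕂 := ℝ) (-h) (0 : ℝ)
  -- The commutator is the derivative of the conjugated x at t = 0, a limit of difference quotients
  -- lying in S.
  have h3 := (h1.mul_const x).mul h2
  have h4 := hasDerivAt_iff_tendsto_slope.1 h3
  simp at h4
  rw [← sub_eq_add_neg] at h4
  refine hS.mem_of_tendsto h4 (Eventually.of_forall fun t => ?_)
  rw [slope_def_module]
  exact S.smul_mem _ (S.sub_mem (hconj t) (hconj 0))

end BanachAlgebra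

/-! ### The Knill–Laflamme condition. -/

namespace QEC

variable {n N K : ℕ}

/-- A family of operators whose joint action on encoded
states is proportional to the identity consists of multiples of the encoding. -/
theorem exists_smul_of_sum_conj {m : ℕ} {V : Matrix (Fin N) (Fin K) ℂ} (hV : V ≠ 0)
    {B : Fin m → Matrix (Fin N) (Fin K) ℂ} {c : ℂ}
    (h : ∀ ρ : Op K, ∑ k, B k * ρ * (B k)ᴴ = c • (V * ρ * Vᴴ)) :
    ∀ k, ∃ α : ℂ, B k = α • V := by
  have hentry : ∀ a i b j, ∑ k, B k a i * star (B k b j) = c * (V a i * star (V b j)) := by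
    intro a i b j
    have := congrFun (congrFun (h (Matrix.single i j 1)) a) b
    simpa [Matrix.sum_apply, Matrix.mul_apply, Matrix.single_apply, ite_and] using this
  obtain ⟨b, j, hbj⟩ : ∃ b j, V b j ≠ 0 := by
    by_contra! hc
    exact hV (by ext b j; exact hc b j)
  intro k
  refine ⟨B k b j / V b j, ?_⟩
  ext a i
  -- The 2×2 minors of B k against V have square sum zero: by `hentry`, each of the four expanded
  -- sums is ±c|V b j|²|V a i|², and they cancel.
  have hz : ∑ k, (V b j * B k a i - V a i * B k b j) * star (V b j * B k a i - V a i * B k b j)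
      = 0 := by
    have : ∀ k, (V b j * B k a i - V a i * B k b j) * star (V b j * B k a i - V a i * B k b j)
        = V b j * star (V b j) * (B k a i * star (B k a i))
          - V b j * star (V a i) * (B k a i * star (B k b j))
          - V a i * star (V b j) * (B k b j * star (B k a i))
          + V a i * star (V a i) * (B k b j * star (B k b j)) := by
      intro k; simp only [star_sub, star_mul']; ring
    simp only [this, Finset.sum_add_distrib, Finset.sum_sub_distrib, ← Finset.mul_sum, hentry]
    ring
  have hz' : ∑ k, ‖V b j * B k a i - V a i * B k b j‖ ^ 2 = 0 := by
    have h' : ∀ z : ℂ, z * star z = ((‖z‖ ^ 2 : ℝ) : ℂ) := fun z => by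
      rw [Complex.star_def, Complex.mul_conj, Complex.normSq_eq_norm_sq]
    simp only [h'] at hz
    exact_mod_cast hz
  have := (Finset.sum_eq_zero_iff_of_nonneg (fun _ _ => by positivity)).1 hz' k (Finset.mem_univ k)
  have h0 : V b j * B k a i - V a i * B k b j = 0 := by simpa using this
  rw [Matrix.smul_apply, smul_eq_mul, div_mul_eq_mul_div, eq_div_iff hbj]
  linear_combination h0

/-- Knill–Laflamme: a correctable error acts on the code space as a scalar, after compression. -/
theorem Code.exists_enc_conj_eq_smul (C : Code N K) (hK : 0 < K) {E : Op N} (hE : E ∈ C.errors) :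
    ∃ c : ℂ, C.encᴴ * E * C.enc = c • (1 : Op K) := by
  obtain ⟨R, ⟨m, A, hA, hR⟩, hrec⟩ := C.correctable
  have hV : C.enc ≠ 0 := by
    intro h0
    have : Nonempty (Fin K) := ⟨⟨0, hK⟩⟩
    have h1 := C.isometry
    rw [h0, Matrix.mul_zero] at h1
    exact zero_ne_one h1
  have key : ∀ E ∈ C.errors, ∀ k, ∃ α : ℂ, A k * E * C.enc = α • C.enc := by
    intro E hE
    obtain ⟨c, hc⟩ := hrec E hE
    refine exists_smul_of_sum_conj (c := c) hV fun ρ => ?_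
    rw [← hc ρ, hR]
    refine Finset.sum_congr rfl fun k _ => ?_
    simp only [Matrix.conjTranspose_mul, Matrix.mul_assoc]
  choose α hα using key E hE
  choose β hβ using key 1 C.one_mem
  refine ⟨∑ k, star (β k) * α k, ?_⟩
  -- Trace preservation inserts ∑ AₖᴴAₖ = 1; each Kraus operator then meets the error E on one side
  -- and the trivial error 1 on the other.
  calc C.encᴴ * E * C.enc = C.encᴴ * (∑ k, (A k)ᴴ * A k) * E * C.enc := by rw [hA, Matrix.mul_one]
    _ = ∑ k, (A k * 1 * C.enc)ᴴ * (A k * E * C.enc) := by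
        simp only [Matrix.mul_sum, Matrix.sum_mul, Matrix.conjTranspose_mul, Matrix.mul_assoc,
          Matrix.mul_one]
    _ = _ := by
        rw [Finset.sum_smul]
        refine Finset.sum_congr rfl fun k _ => ?_
        rw [hα, hβ, Matrix.conjTranspose_smul, Matrix.smul_mul, Matrix.mul_smul, C.isometry,
          smul_smul]

end QEC

namespace QEC

variable {n N K : ℕ}

/-! ### Block decompositions and complex matrix Lie algebras. -/

section Corners

variable {D : Submodule ℂ (Op n)} {P Q : Op n}

/-- An off-diagonal corner is irreducible under the block diagonal matrices. -/
theorem corner_mem (hP : P * P = P) (hPQ : P + Q = 1)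
    (hinv : ∀ H, H * P = P * H → ∀ X ∈ D, H * X - X * H ∈ D)
    {X : Op n} (hX : X ∈ D) (hne : P * X * Q ≠ 0) (m : Op n) : P * m * Q ∈ D := by
  obtain rfl : Q = 1 - P := eq_sub_of_add_eq' hPQ
  have hPR (m : Op n) : P * (P * m) = P * m := by rw [← mul_assoc, hP]
  set Y : Op n := P * X * (1 - P) with hY
  have hYmem : Y ∈ D := by
    -- With Q = 1 - P, ad P sends X to PXQ - QXP and (ad P)² sends it to PXQ + QXP; half their sum
    -- is the corner Y.
    have h1 := hinv P rfl X hX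
    have h2 := D.smul_mem (2⁻¹ : ℂ) (D.add_mem h1 (hinv P rfl _ h1))
    convert h2 using 1
    have : P * X - X * P + (P * (P * X - X * P) - (P * X - X * P) * P) = (2 : ℂ) • Y := by
      simp only [hY, mul_sub, sub_mul, mul_assoc, hP, hPR, mul_one, two_smul]
      abel
    rw [this, smul_smul]
    norm_num
  -- Bracketing Y with the diagonal blocks PaP and QbQ multiplies it on the left and on the right;
  -- matrix units for a and b then isolate a nonzero entry of Y.
  have hlr (a b : Op n) : P * a * Y * (b * (1 - P)) ∈ D := by
    have h1 := hinv (P * a * P) (by simp only [mul_assoc, hP, hPR]) Y hYmem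
    have h2 := hinv ((1 - P) * b * (1 - P))
      (by simp only [mul_sub, sub_mul, mul_assoc, hP, hPR, mul_one, one_mul]; abel) _ h1
    convert D.neg_mem h2 using 1
    simp only [hY, mul_sub, sub_mul, mul_assoc, hPR, mul_one, one_mul]
    abel
  obtain ⟨i, j, hij⟩ : ∃ i j, Y i j ≠ 0 := by
    by_contra! hc
    exact hne (by ext i j; exact hc i j)
  have hsingle (a b : Fin n) : P * Matrix.single a b 1 * (1 - P) ∈ D := by
    have h1 := D.smul_mem (Y i j)⁻¹ (hlr (Matrix.single a i 1) (Matrix.single j b 1))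
    convert h1 using 1
    have : Matrix.single a i 1 * Y * Matrix.single j b 1 = (Y i j) • Matrix.single a b (1 : ℂ) := by
      simp
    rw [show P * Matrix.single a i 1 * Y * (Matrix.single j b 1 * (1 - P))
      = P * (Matrix.single a i 1 * Y * Matrix.single j b 1) * (1 - P) by simp only [mul_assoc],
      this]
    rw [mul_smul_comm, smul_mul_assoc, smul_smul, inv_mul_cancel₀ hij, one_smul]
  rw [Matrix.matrix_eq_sum_single m]
  simp only [Finset.mul_sum, Finset.sum_mul]
  refine D.sum_mem fun a _ => D.sum_mem fun b _ => ?_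
  have : Matrix.single a b (m a b) = m a b • Matrix.single a b (1 : ℂ) := by simp
  rw [this, mul_smul_comm, smul_mul_assoc]
  exact D.smul_mem _ (hsingle a b)

/-- Modulo a Lie algebra containing both off-diagonal corners, a diagonal block is
its trace times a fixed matrix. -/
theorem exists_block_sub_smul_mem (hP : P * P = P) (hPQ : P + Q = 1)
    (hlie : ∀ X ∈ D, ∀ Y ∈ D, X * Y - Y * X ∈ D)
    (hc₁ : ∀ m, P * m * Q ∈ D) (hc₂ : ∀ m, Q * m * P ∈ D) {i j : Fin n} (hij : Q i j ≠ 0)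
    (a b : Fin n) :
    P * Matrix.single a b 1 * P - (P b a * (Q i j)⁻¹) • (Q * Matrix.single j i 1 * Q) ∈ D := by
  have hQ : Q * Q = Q := by
    obtain rfl : Q = 1 - P := eq_sub_of_add_eq' hPQ
    simp only [mul_sub, sub_mul, hP, mul_one, one_mul]
    abel
  -- The bracket of P Eₐᵢ Q with Q Eⱼᵦ P, where b indexes the last unit, is Q i j • P Eₐᵦ P - P b a
  -- • Q Eⱼᵢ Q.
  have h1 := D.smul_mem (Q i j)⁻¹
    (hlie _ (hc₁ (Matrix.single a i 1)) _ (hc₂ (Matrix.single j b 1)))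
  convert h1 using 1
  have e1 : P * Matrix.single a i 1 * Q * (Q * Matrix.single j b 1 * P)
      = Q i j • (P * Matrix.single a b 1 * P) := by
    rw [show P * Matrix.single a i 1 * Q * (Q * Matrix.single j b 1 * P)
      = P * (Matrix.single a i 1 * (Q * Q) * Matrix.single j b 1) * P by simp only [mul_assoc], hQ]
    have : Matrix.single a i 1 * Q * Matrix.single j b 1 = (Q i j) • Matrix.single a b (1 : ℂ) := by
      simp
    rw [this, mul_smul_comm, smul_mul_assoc]
  have e2 : Q * Matrix.single j b 1 * P * (P * Matrix.single a i 1 * Q)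
      = P b a • (Q * Matrix.single j i 1 * Q) := by
    rw [show Q * Matrix.single j b 1 * P * (P * Matrix.single a i 1 * Q)
      = Q * (Matrix.single j b 1 * (P * P) * Matrix.single a i 1) * Q by simp only [mul_assoc], hP]
    have : Matrix.single j b 1 * P * Matrix.single a i 1 = (P b a) • Matrix.single j i (1 : ℂ) := by
      simp
    rw [this, mul_smul_comm, smul_mul_assoc]
  rw [e1, e2, smul_sub, smul_smul, smul_smul, inv_mul_cancel₀ hij, one_smul, mul_comm]

/-- A complex Lie algebra of matrices that contains the identity and both off-diagonal corners of
a nontrivial block decomposition is the algebra of all matrices. -/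
theorem eq_top_of_corners (hP : P * P = P) (hPQ : P + Q = 1) (hP0 : P ≠ 0) (hQ0 : Q ≠ 0)
    (h1 : (1 : Op n) ∈ D) (hlie : ∀ X ∈ D, ∀ Y ∈ D, X * Y - Y * X ∈ D)
    (hc₁ : ∀ m, P * m * Q ∈ D) (hc₂ : ∀ m, Q * m * P ∈ D) : D = ⊤ := by
  have hQ : Q * Q = Q := by
    obtain rfl : Q = 1 - P := eq_sub_of_add_eq' hPQ
    simp only [mul_sub, sub_mul, hP, mul_one, one_mul]
    abel
  obtain ⟨i, j, hij⟩ : ∃ i j, Q i j ≠ 0 := by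
    by_contra! hc
    exact hQ0 (by ext i j; exact hc i j)
  obtain ⟨k, l, hkl⟩ : ∃ i j, P i j ≠ 0 := by
    by_contra! hc
    exact hP0 (by ext i j; exact hc i j)
  set Z : Op n := (Q i j)⁻¹ • (Q * Matrix.single j i 1 * Q) with hZ
  set Z' : Op n := (P k l)⁻¹ • (P * Matrix.single l k 1 * P) with hZ'
  have hPb (a b : Fin n) : D.mkQ (P * Matrix.single a b 1 * P) = P b a • D.mkQ Z := by
    have := exists_block_sub_smul_mem hP hPQ hlie hc₁ hc₂ hij a b
    rw [← map_smul, ← sub_eq_zero, ← map_sub, Submodule.mkQ_apply, Submodule.Quotient.mk_eq_zero,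
      hZ, smul_smul]
    exact this
  have hQb (a b : Fin n) : D.mkQ (Q * Matrix.single a b 1 * Q) = Q b a • D.mkQ Z' := by
    have := exists_block_sub_smul_mem hQ (add_comm P Q ▸ hPQ) hlie hc₂ hc₁ hkl a b
    rw [← map_smul, ← sub_eq_zero, ← map_sub, Submodule.mkQ_apply, Submodule.Quotient.mk_eq_zero,
      hZ', smul_smul]
    exact this
  -- The two blocks share one trace class, so modulo D every matrix m becomes tr(m) Z; since 1 ∈ D,
  -- n Z vanishes modulo D, and hence so does Z.
  have hZZ : D.mkQ Z = D.mkQ Z' := by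
    rw [hZ, map_smul, hQb, smul_smul, inv_mul_cancel₀ hij, one_smul]
  have hE (a b : Fin n) : D.mkQ (Matrix.single a b 1) = (1 : Op n) b a • D.mkQ Z := by
    have hsplit : Matrix.single a b (1 : ℂ) = P * Matrix.single a b 1 * P
        + P * Matrix.single a b 1 * Q + Q * Matrix.single a b 1 * P
        + Q * Matrix.single a b 1 * Q := by
      calc Matrix.single a b (1 : ℂ) = (P + Q) * Matrix.single a b 1 * (P + Q) := by
            rw [hPQ, one_mul, mul_one]
        _ = _ := by simp only [add_mul, mul_add]; abel
    have z1 : D.mkQ (P * Matrix.single a b 1 * Q) = 0 := by simpa using hc₁ _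
    have z2 : D.mkQ (Q * Matrix.single a b 1 * P) = 0 := by simpa using hc₂ _
    rw [hsplit, map_add, map_add, map_add, z1, z2, hPb, hQb, ← hZZ, add_zero, add_zero, ← add_smul,
      ← Matrix.add_apply, hPQ]
  have hZ0 : D.mkQ Z = 0 := by
    have hsum : (1 : Op n) = ∑ a, Matrix.single a a 1 := by
      ext x y
      simp [Matrix.sum_apply, Matrix.single_apply, Matrix.one_apply, ite_and]
    have h2 : D.mkQ (1 : Op n) = 0 := by simpa using h1
    rw [hsum, map_sum] at h2
    simp only [hE, Matrix.one_apply_eq, one_smul, Finset.sum_const, Finset.card_univ,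
      Fintype.card_fin] at h2
    have hn : n ≠ 0 := by rintro rfl; exact i.elim0
    rw [← Nat.cast_smul_eq_nsmul ℂ, smul_eq_zero] at h2
    exact h2.resolve_left (by exact_mod_cast hn)
  rw [eq_top_iff]
  intro m _
  rw [Matrix.matrix_eq_sum_single m]
  refine D.sum_mem fun a _ => D.sum_mem fun b _ => ?_
  have : Matrix.single a b (m a b) = m a b • Matrix.single a b (1 : ℂ) := by simp
  rw [this]
  refine D.smul_mem _ ?_
  have := hE a b
  rw [hZ0, smul_zero] at this
  simpa using this

end Corners
end QEC

/-! ### Products of one-parameter groups near the identity. -/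

section LocalSurjectivity

open NormedSpace Filter Topology

variable {A : Type*} [NormedRing A] [NormedAlgebra ℝ A] [CompleteSpace A]

/-- The derivative at the origin of a product of one-parameter groups. -/
theorem hasStrictFDerivAt_list_prod_exp {ι : Type*} [Fintype ι] (X : ι → A) (l : List ι) :
    HasStrictFDerivAt (fun t : ι → ℝ => (l.map fun i => exp (t i • X i)).prod)
      (l.map fun i => (ContinuousLinearMap.proj (R := ℝ) (φ := fun _ : ι => ℝ) i).smulRight
        (X i)).sum 0 := by
  let _ : NormedAlgebra ℚ A := NormedAlgebra.restrictScalars ℚ ℝ A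
  induction l with
  | nil => simpa using hasStrictFDerivAt_const (1 : A) (0 : ι → ℝ)
  | cons i l ih =>
    have h1 : HasStrictFDerivAt (fun t : ι → ℝ => t i • X i)
        ((ContinuousLinearMap.proj (R := ℝ) (φ := fun _ : ι => ℝ) i).smulRight (X i)) 0 :=
      ((ContinuousLinearMap.proj (R := ℝ) (φ := fun _ : ι => ℝ) i).smulRight
        (X i)).hasStrictFDerivAt
    have h2 : HasStrictFDerivAt (exp : A → A) (1 : A →L[ℝ] A) ((0 : ι → ℝ) i • X i) := by
      simpa using hasStrictFDerivAt_exp_zero (𝕂 := ℝ) (𝔸 := A)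
    have h3 := (h2.comp (0 : ι → ℝ) h1).mul' ih
    simp only [List.map_cons, List.prod_cons, List.sum_cons]
    refine h3.congr_fderiv ?_
    ext t
    simp [add_comm]

variable [StarRing A] [ContinuousStar A] [StarModule ℝ A]

/-- Unitaries close to the identity are products of elements of one-parameter groups whose
generators span the skew-adjoint elements. -/
theorem eventually_unitary_eq_list_prod_exp {ι : Type*} [Fintype ι] {X : ι → A}
    (hX : ∀ i, star (X i) = -X i)
    (hspan : ∀ Z : A, star Z = -Z → Z ∈ Submodule.span ℝ (Set.range X)) :
    ∀ᶠ u in 𝓝 (1 : A), u ∈ unitary A →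
      ∃ (l : List ι) (t : ι → ℝ), u = (l.map fun i => exp (t i • X i)).prod := by
  let _ : NormedAlgebra ℚ A := NormedAlgebra.restrictScalars ℚ ℝ A
  set l : List ι := Finset.univ.toList with hl
  set φ : (ι → ℝ) → A := fun t => (l.map fun i => exp (t i • X i)).prod with hφ
  have hφ0 : φ 0 = 1 := List.prod_eq_one (by simp)
  have hφu (t : ι → ℝ) : φ t ∈ unitary A := by
    refine list_prod_mem ?_
    intro y hy
    obtain ⟨i, -, rfl⟩ := List.mem_map.1 hy
    have hs : star (t i • X i) = -(t i • X i) := by rw [star_smul, hX, star_trivial, smul_neg]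
    have hs' : star (exp (t i • X i)) = exp (-(t i • X i)) := by rw [star_exp, hs]
    rw [Unitary.mem_iff, hs', ← exp_add_of_commute (Commute.refl _).neg_left,
      ← exp_add_of_commute (Commute.refl _).neg_right]
    simp
  -- Local polar decomposition: the parameters t cover the skew-adjoint directions and the
  -- self-adjoint factor 1 + σ y covers the rest, so f has surjective derivative at 0 and is open
  -- there.
  set σ : A →L[ℝ] A := ContinuousLinearMap.id ℝ A + (starL' ℝ : A ≃L[ℝ] A).toContinuousLinearMap
    with hσ
  have hσa (y : A) : σ y = y + star y := by simp [hσ]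
  set f : (ι → ℝ) × A → A := fun p => φ p.1 * (1 + σ p.2) with hf
  have hd₁ : HasStrictFDerivAt (fun p : (ι → ℝ) × A => φ p.1) _ 0 :=
    (hasStrictFDerivAt_list_prod_exp X l).comp (0 : (ι → ℝ) × A) hasStrictFDerivAt_fst
  have hd₂ : HasStrictFDerivAt (fun p : (ι → ℝ) × A => 1 + σ p.2) _ 0 :=
    (σ.hasStrictFDerivAt.comp (0 : (ι → ℝ) × A) hasStrictFDerivAt_snd).const_add 1
  have hd : HasStrictFDerivAt f _ 0 := hd₁.mul' hd₂
  have hf0 : f 0 = 1 := by simp [hf, hφ0]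
  have hmap := hd.map_nhds_eq_of_surj (by
    rw [LinearMap.range_eq_top]
    intro z
    have hz : (2⁻¹ : ℝ) • (z - star z) ∈ Submodule.span ℝ (Set.range X) := by
      refine hspan _ ?_
      rw [star_smul, star_sub, star_star, star_trivial, ← smul_neg, neg_sub]
    obtain ⟨c, hc⟩ := (Submodule.mem_span_range_iff_exists_fun ℝ).1 hz
    refine ⟨(c, (4⁻¹ : ℝ) • (z + star z)), ?_⟩
    have hsum : ∑ i, c i • X i = (l.map fun i => c i • X i).sum := by
      rw [hl, Finset.sum_map_toList]
    have hsum' : (l.map fun i => (ContinuousLinearMap.proj (R := ℝ) (φ := fun _ : ι => ℝ) i).smulRight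
        (X i)).sum c = ∑ i, c i • X i := by
      rw [hl, Finset.sum_map_toList, sum_apply]
      simp
    simp [hφ0, hsum', hσa, hc]
    module)
  rw [hf0] at hmap
  -- Radius 2 forces the self-adjoint factor to be trivial: if 1 + h is unitary and h self-adjoint,
  -- then h² = -2h, so h = 0 or ‖h‖ ≥ 2.
  have hs : {p : (ι → ℝ) × A | ‖σ p.2‖ < 2} ∈ 𝓝 (0 : (ι → ℝ) × A) := by
    refine (isOpen_lt (by fun_prop) continuous_const).mem_nhds ?_
    simp
  have him : f '' {p | ‖σ p.2‖ < 2} ∈ 𝓝 (1 : A) := hmap ▸ image_mem_map hs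
  filter_upwards [him] with u ⟨⟨t, y⟩, hy, hu⟩ huu
  refine ⟨l, t, ?_⟩
  set h : A := σ y with hh
  have hsa : star h = h := by rw [hh, hσa, star_add, star_star, add_comm]
  have hv : 1 + h ∈ unitary A := by
    have : 1 + h = star (φ t) * u := by
      rw [← hu, hf, ← mul_assoc, Unitary.star_mul_self_of_mem (hφu t), one_mul]
    rw [this]
    exact mul_mem (Unitary.star_mem (hφu t)) huu
  have hsq : (2 : ℝ) • h = -(h * h) := by
    have := Unitary.star_mul_self_of_mem hv
    rw [star_add, star_one, hsa] at this
    rw [two_smul, eq_neg_iff_add_eq_zero, ← sub_eq_zero.2 this]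
    noncomm_ring
  have h0 : h = 0 := by
    by_contra hne
    have hpos : 0 < ‖h‖ := norm_pos_iff.2 hne
    have h1 : 2 * ‖h‖ ≤ ‖h‖ * ‖h‖ := by
      calc 2 * ‖h‖ = ‖(2 : ℝ) • h‖ := by rw [norm_smul]; norm_num
        _ ≤ ‖h‖ * ‖h‖ := by rw [hsq, norm_neg]; exact norm_mul_le _ _
    have h2 : ‖h‖ < 2 := hy
    nlinarith
  rw [← hu]
  change φ t * (1 + h) = φ t
  rw [h0, add_zero, mul_one]

end LocalSurjectivity

/-! ### Logarithms of unitary matrices. -/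

section UnitaryExp

open scoped Matrix.Norms.L2Operator

/-- Up to a phase, every unitary matrix is the exponential of a skew-Hermitian matrix. -/
theorem Matrix.exists_phase_smul_eq_exp {n : ℕ} (u : Matrix (Fin n) (Fin n) ℂ)
    (hu : u ∈ unitary (Matrix (Fin n) (Fin n) ℂ)) :
    ∃ (θ : ℝ) (X : Matrix (Fin n) (Fin n) ℂ), Xᴴ = -X ∧
      u = NormedSpace.exp ((θ * Complex.I) • (1 : Matrix (Fin n) (Fin n) ℂ)) *
        NormedSpace.exp X := by
  -- The spectrum is finite and the circle infinite, so some rotation moves the spectrum off -1,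
  -- where the principal argument is discontinuous.
  obtain ⟨z, hz⟩ : ∃ z : Circle, -(z : ℂ) ∉ spectrum ℂ u := by
    by_contra! hc
    have : Infinite (Set.Ioc (-Real.pi) Real.pi) :=
      (Set.Ioc_infinite (by linarith [Real.pi_pos])).to_subtype
    have : Infinite Circle := Infinite.of_injective _ Circle.argEquiv.symm.injective
    have hinj : Function.Injective fun z : Circle => -(z : ℂ) := fun a b hab =>
      Circle.coe_injective (neg_injective hab)
    exact Set.infinite_range_of_injective hinj
      ((Matrix.finite_spectrum u).subset (by rintro _ ⟨z, rfl⟩; exact hc z))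
  obtain ⟨θ, rfl⟩ := Circle.exp_surjective z
  have hz0 : Complex.exp (θ * Complex.I) ≠ 0 := Complex.exp_ne_zero _
  have hphase : NormedSpace.exp ((θ * Complex.I) • (1 : Matrix (Fin n) (Fin n) ℂ))
      = Complex.exp (θ * Complex.I) • (1 : Matrix (Fin n) (Fin n) ℂ) := by
    rw [← Algebra.algebraMap_eq_smul_one, ← Algebra.algebraMap_eq_smul_one, Complex.exp_eq_exp_ℂ]
    exact (NormedSpace.algebraMap_exp_comm (𝕂 := ℂ) _).symm
  set v : Matrix (Fin n) (Fin n) ℂ := (Complex.exp (θ * Complex.I))⁻¹ • u with hv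
  have huv : u = Complex.exp (θ * Complex.I) • v := by
    rw [hv, smul_smul, mul_inv_cancel₀ hz0, one_smul]
  have hstar : star (Complex.exp (θ * Complex.I)) * Complex.exp (θ * Complex.I) = 1 := by
    rw [Complex.star_def, ← Complex.normSq_eq_conj_mul_self, Complex.normSq_eq_norm_sq,
      Complex.norm_exp_ofReal_mul_I]
    simp
  have hinv : (Complex.exp (θ * Complex.I))⁻¹ = star (Complex.exp (θ * Complex.I)) :=
    (eq_inv_of_mul_eq_one_left hstar).symm
  have hvu : v ∈ unitary (Matrix (Fin n) (Fin n) ℂ) := by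
    rw [Unitary.mem_iff, hv, hinv, star_smul, star_star, smul_mul_smul_comm, smul_mul_smul_comm,
      Unitary.star_mul_self_of_mem hu, Unitary.mul_star_self_of_mem hu, hstar, mul_comm, hstar]
    simp
  have hspec : -1 ∉ spectrum ℂ v := by
    intro hmem
    refine hz ?_
    rw [huv, Circle.coe_exp]
    have := (spectrum.smul_mem_smul_iff (r := Units.mk0 _ hz0)).2 hmem
    simpa [Units.smul_def] using this
  have hexp := expUnitary_argSelfAdjoint (u := ⟨v, hvu⟩)
    ((Unitary.norm_sub_one_lt_two_iff hvu).2 hspec)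
  set a := Unitary.argSelfAdjoint (⟨v, hvu⟩ : unitary (Matrix (Fin n) (Fin n) ℂ))
  refine ⟨θ, Complex.I • (a : Matrix (Fin n) (Fin n) ℂ), ?_, ?_⟩
  · have : (a : Matrix (Fin n) (Fin n) ℂ)ᴴ = a := a.2
    rw [Matrix.conjTranspose_smul, this]
    simp
  · have := congrArg Subtype.val hexp
    rw [selfAdjoint.expUnitary_coe] at this
    rw [hphase, this, smul_mul_assoc, one_mul]
    exact huv

end UnitaryExp

/-! ### The universality condition makes every unitary fault-tolerant. -/

section
open NormedSpace Filter Topology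

attribute [local instance] Matrix.linftyOpNormedRing Matrix.linftyOpNormedAlgebra

namespace QEC
variable {n N K : ℕ}

theorem mem_physicalAlgebra {X : Op n} : X ∈ physicalAlgebra n ↔ Xᴴ = -X := Iff.rfl

theorem exp_mem_unitaryGroup {X : Op n} (hX : Xᴴ = -X) : exp X ∈ Matrix.unitaryGroup (Fin n) ℂ := by
  rw [Matrix.mem_unitaryGroup_iff, Matrix.star_eq_conjTranspose, ← Matrix.exp_conjTranspose, hX,
    ← Matrix.exp_add_of_commute _ _ (Commute.refl X).neg_right, add_neg_cancel, exp_zero]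

theorem conjTranspose_real_smul {X : Op n} (hX : Xᴴ = -X) (t : ℝ) : (t • X)ᴴ = -(t • X) := by
  rw [Matrix.conjTranspose_smul, hX, star_trivial, smul_neg]

theorem conj_unitary_exp (W : U n) (X : Op n) :
    exp ((W : Op n) * X * (W : Op n)ᴴ) = (W : Op n) * exp X * (W : Op n)ᴴ := by
  have h := Matrix.exp_units_conj (Unitary.toUnits W) X
  exact h

namespace Code

variable (C : Code N K)

/-- The code's own recovery, conjugated by W, has Kraus operators W Aₖ Wᴴ and corrects the carried
errors with the same constants. -/
theorem exists_isECStep (W : U N) : ∃ Φ, C.IsECStep W Φ := by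
  obtain ⟨R, ⟨m, A, hA, hR⟩, hrec⟩ := C.correctable
  have hW : (W : Op N)ᴴ * (W : Op N) = 1 := Unitary.coe_star_mul_self W
  have hW' : (W : Op N) * (W : Op N)ᴴ = 1 := Unitary.coe_mul_star_self W
  have hWl (M : Op N) : (W : Op N)ᴴ * ((W : Op N) * M) = M := by rw [← mul_assoc, hW, one_mul]
  refine ⟨conjMap (W : Op N) ∘ₗ R ∘ₗ conjMap (W : Op N)ᴴ,
    ⟨m, fun k => (W : Op N) * A k * (W : Op N)ᴴ, ?_, fun ρ => ?_⟩, ?_⟩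
  · calc ∑ k, ((W : Op N) * A k * (W : Op N)ᴴ)ᴴ * ((W : Op N) * A k * (W : Op N)ᴴ)
        = (W : Op N) * (∑ k, (A k)ᴴ * A k) * (W : Op N)ᴴ := by
          rw [Finset.mul_sum, Finset.sum_mul]
          refine Finset.sum_congr rfl fun k _ => ?_
          simp only [Matrix.conjTranspose_mul, Matrix.conjTranspose_conjTranspose, mul_assoc, hWl]
      _ = 1 := by rw [hA, mul_one, hW']
  · simp only [conjMap, LinearMap.comp_apply, LinearMap.mulLeft_apply, LinearMap.mulRight_apply,
      hR, Finset.mul_sum, Finset.sum_mul, Matrix.conjTranspose_mul,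
      Matrix.conjTranspose_conjTranspose, mul_assoc]
  · rintro _ ⟨E, hE, rfl⟩
    obtain ⟨c, hc⟩ := hrec E hE
    refine ⟨c, fun ρ => ?_⟩
    have harg : (W : Op N)ᴴ * ((W : Op N) * E * (W : Op N)ᴴ *
        ((W : Op N) * C.enc * ρ * ((W : Op N) * C.enc)ᴴ) * ((W : Op N) * E * (W : Op N)ᴴ)ᴴ) *
        (W : Op N)ᴴᴴ = E * (C.enc * ρ * C.encᴴ) * Eᴴ := by
      simp only [Matrix.conjTranspose_mul, Matrix.conjTranspose_conjTranspose, Matrix.mul_assoc, hWl,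
        hW, Matrix.mul_one]
    simp only [conjMap, LinearMap.comp_apply, LinearMap.mulLeft_apply, LinearMap.mulRight_apply]
    rw [harg, hc]
    simp only [Matrix.mul_smul, Matrix.smul_mul, Matrix.conjTranspose_mul, Matrix.mul_assoc]

variable {C}

theorem one_mem_faultTolerant : (1 : U N) ∈ C.faultTolerant := ⟨_, .nil⟩

theorem exp_mul_mem_faultTolerant {W F : U N} (hW : W ∈ C.faultTolerant) {X : Op N}
    (hX : X ∈ C.gens) (hF : (F : Op N) = exp X) : F * W ∈ C.faultTolerant := by
  obtain ⟨Φ, hΦ⟩ := hW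
  obtain ⟨EC, hEC⟩ := C.exists_isECStep (F * W)
  exact ⟨_, .step W Φ F X EC hΦ hX hF hEC⟩

/-- Induction over the gates of a fault-tolerant operator. -/
theorem faultTolerant_induction {p : U N → Prop} (one : p 1)
    (step : ∀ (W F : U N) (X : Op N), W ∈ C.faultTolerant → X ∈ C.gens → (F : Op N) = exp X → p W →
      p (F * W)) {W : U N} (hW : W ∈ C.faultTolerant) : p W := by
  obtain ⟨Φ, hΦ⟩ := hW
  induction hΦ with
  | nil => exact one
  | step W Φ F X EC h hX hF _ ih => exact step W F X ⟨Φ, h⟩ hX hF ih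

theorem smul_mem_gens {X : Op N} (hX : X ∈ C.gens) (t : ℝ) : t • X ∈ C.gens := by
  refine ⟨?_, (physicalAlgebra N).smul_mem t hX.2⟩
  have : t • X = (t : ℂ) • X := by ext; simp
  rw [this]
  exact C.errors.smul_mem _ hX.1

theorem mul_I_smul_one_mem_gens (t : ℝ) : (t * Complex.I) • (1 : Op N) ∈ C.gens := by
  refine ⟨C.errors.smul_mem _ C.one_mem, ?_⟩
  rw [mem_physicalAlgebra, Matrix.conjTranspose_smul, Matrix.conjTranspose_one]
  simp

/-- The fault-tolerant operators form a group. -/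
def faultTolerantGroup (C : Code N K) : Subgroup (U N) where
  carrier := C.faultTolerant
  one_mem' := one_mem_faultTolerant
  mul_mem' {W W'} hW hW' := by
    refine faultTolerant_induction (p := fun W => W * W' ∈ C.faultTolerant) (by simpa)
      (fun W F X _ hX hF ih => ?_) hW
    rw [mul_assoc]
    exact exp_mul_mem_faultTolerant ih hX hF
  inv_mem' {W} hW := by
    -- Gates are added on the left of W, hence on the right of W⁻¹; the extra factor W' absorbs
    -- them. The inverse of a gate exp X is the gate exp(-X).
    have key : ∀ W' ∈ C.faultTolerant, W⁻¹ * W' ∈ C.faultTolerant := by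
      refine faultTolerant_induction
        (p := fun W => ∀ W' ∈ C.faultTolerant, W⁻¹ * W' ∈ C.faultTolerant) (by simp)
        (fun W F X _ hX hF ih W' hW' => ?_) hW
      rw [mul_inv_rev, mul_assoc]
      refine ih _ (exp_mul_mem_faultTolerant hW' (by simpa using smul_mem_gens hX (-1)) ?_)
      rw [Matrix.exp_neg, ← hF]
      exact (Matrix.inv_eq_left_inv (Unitary.coe_star_mul_self F)).symm
    simpa using key 1 one_mem_faultTolerant

theorem exp_mem_faultTolerantGroup {F : U N} {X : Op N} (hX : X ∈ C.gens)
    (hF : (F : Op N) = exp X) : F ∈ C.faultTolerantGroup := by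
  have h := exp_mul_mem_faultTolerant one_mem_faultTolerant hX hF
  rwa [mul_one] at h

/-- The fault-tolerant conjugates of the correctable errors. -/
def gensOrbit (C : Code N K) : Set (Op N) :=
  {Y | ∃ W ∈ C.faultTolerantGroup, ∃ X ∈ C.gens, Y = (W : Op N) * X * (W : Op N)ᴴ}

theorem conj_mem_span_gensOrbit {W : U N} (hW : W ∈ C.faultTolerantGroup) {Y : Op N}
    (hY : Y ∈ Submodule.span ℝ C.gensOrbit) :
    (W : Op N) * Y * (W : Op N)ᴴ ∈ Submodule.span ℝ C.gensOrbit := by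
  induction hY using Submodule.span_induction with
  | mem Y hY =>
    obtain ⟨W', hW', X, hX, rfl⟩ := hY
    refine Submodule.subset_span ⟨W * W', mul_mem hW hW', X, hX, ?_⟩
    simp [mul_assoc]
  | zero => simp
  | add Y Z _ _ hY hZ => rw [mul_add, add_mul]; exact add_mem hY hZ
  | smul t Y _ hY => rw [mul_smul_comm, smul_mul_assoc]; exact Submodule.smul_mem _ _ hY

theorem isClosed_submodule (S : Submodule ℝ (Op n)) : IsClosed (S : Set (Op n)) :=
  S.closed_of_finiteDimensional

/-- Each exp(tX) is itself fault-tolerant, so it preserves the span of the orbit; differentiate at t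
= 0. -/
theorem gens_lie_mem_span_gensOrbit {X Y : Op N} (hX : X ∈ C.gens)
    (hY : Y ∈ Submodule.span ℝ C.gensOrbit) : X * Y - Y * X ∈ Submodule.span ℝ C.gensOrbit := by
  refine Submodule.mul_sub_mul_mem_of_exp (isClosed_submodule _) fun t => ?_
  have hskew := (smul_mem_gens hX t).2
  have := conj_mem_span_gensOrbit (exp_mem_faultTolerantGroup
    (F := ⟨exp (t • X), exp_mem_unitaryGroup hskew⟩) (smul_mem_gens hX t) rfl) hY
  have hneg : exp (-(t • X)) = (exp (t • X))ᴴ := by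
    rw [← mem_physicalAlgebra.1 hskew, Matrix.exp_conjTranspose]
  have h := hneg ▸ this
  exact h

/-- The Lie algebra generated by the errors is spanned by their fault-tolerant conjugates. -/
theorem errorAlgebra_le_span_gensOrbit {Y : Op N} (hY : Y ∈ C.errorAlgebra) :
    Y ∈ Submodule.span ℝ C.gensOrbit := by
  set S := Submodule.span ℝ C.gensOrbit with hS
  -- The span is not known to be a Lie algebra. Carrying its stability under ad Y through the
  -- induction suffices, brackets being handled by the Jacobi identity.
  suffices h : Y ∈ S ∧ ∀ Z ∈ S, Y * Z - Z * Y ∈ S from h.1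
  refine LieSubalgebra.lieSpan_induction ℝ
    (p := fun Y _ => Y ∈ S ∧ ∀ Z ∈ S, Y * Z - Z * Y ∈ S) ?_ ?_ ?_ ?_ ?_ hY
  · intro X hX
    refine ⟨Submodule.subset_span ⟨1, C.faultTolerantGroup.one_mem, X, hX, by simp⟩, fun Z hZ => ?_⟩
    exact gens_lie_mem_span_gensOrbit hX hZ
  · exact ⟨zero_mem _, fun Z _ => by simp⟩
  · rintro X Y _ _ ⟨hX, hX'⟩ ⟨hY, hY'⟩
    refine ⟨add_mem hX hY, fun Z hZ => ?_⟩
    convert add_mem (hX' Z hZ) (hY' Z hZ) using 1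
    noncomm_ring
  · rintro t X _ ⟨hX, hX'⟩
    refine ⟨S.smul_mem _ hX, fun Z hZ => ?_⟩
    rw [mul_smul_comm, smul_mul_assoc, ← smul_sub]
    exact S.smul_mem _ (hX' Z hZ)
  · rintro X Y _ _ ⟨hX, hX'⟩ ⟨hY, hY'⟩
    rw [Ring.lie_def]
    refine ⟨hX' Y hY, fun Z hZ => ?_⟩
    convert sub_mem (hX' _ (hY' Z hZ)) (hY' _ (hX' Z hZ)) using 1
    noncomm_ring

/-- Under the universality condition, every unitary is fault-tolerant. -/
theorem faultTolerantGroup_eq_top (hC : C.UniversalityCondition) : C.faultTolerantGroup = ⊤ := by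
  set T : Submonoid (Op N) :=
    C.faultTolerantGroup.toSubmonoid.map (Matrix.unitaryGroup (Fin N) ℂ).subtype with hT
  have hTmem {W : U N} : (W : Op N) ∈ T ↔ W ∈ C.faultTolerantGroup := by
    simp [hT]
  -- Finite dimension allows finitely many conjugates to span, giving finitely many coordinates t.
  obtain ⟨s, hs, hspan⟩ := (Submodule.fg_span_iff_fg_span_finset_subset C.gensOrbit).1
    (IsNoetherian.noetherian (Submodule.span ℝ C.gensOrbit))
  have hnear : ∀ᶠ u in 𝓝 (1 : Op N), u ∈ unitary (Op N) → u ∈ T := by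
    have hskew : ∀ i : s, star (i : Op N) = -(i : Op N) := by
      rintro ⟨i, hi⟩
      obtain ⟨W, -, X, hX, rfl⟩ := hs hi
      have hX' : Xᴴ = -X := hX.2
      simp [Matrix.star_eq_conjTranspose, hX', mul_assoc]
    have hstar : @ContinuousStar (Op N)
        (Matrix.linftyOpNormedRing (n := Fin N) (α := ℂ)).toUniformSpace.toTopologicalSpace _ :=
      @ContinuousStar.mk _ (_) _ (continuous_id.matrix_conjTranspose)
    have := @eventually_unitary_eq_list_prod_exp (Op N) _ _ _ _ hstar _ _ _
      (X := fun i : s => (i : Op N)) hskew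
      (fun Z hZ => by
        rw [Subtype.range_coe_subtype]
        change Z ∈ Submodule.span ℝ (s : Set (Op N))
        rw [← hspan]
        refine errorAlgebra_le_span_gensOrbit ?_
        rw [show C.errorAlgebra = physicalAlgebra N from hC]
        exact hZ)
    filter_upwards [this] with u hu huu
    obtain ⟨l, t, rfl⟩ := hu huu
    refine list_prod_mem fun y hy => ?_
    obtain ⟨⟨i, hi⟩, -, rfl⟩ := List.mem_map.1 hy
    obtain ⟨W, hW, X, hX, rfl⟩ := hs hi
    have htX := smul_mem_gens hX (t ⟨_, hi⟩)
    have hconj : exp (t ⟨_, hi⟩ • ((W : Op N) * X * (W : Op N)ᴴ))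
        = (W : Op N) * exp (t ⟨_, hi⟩ • X) * (W : Op N)ᴴ := by
      rw [← conj_unitary_exp, mul_smul_comm, smul_mul_assoc]
    refine (show _ = _ from hconj) ▸ T.mul_mem (T.mul_mem (hTmem.2 hW) (hTmem.2 (exp_mem_faultTolerantGroup
      (F := ⟨_, exp_mem_unitaryGroup htX.2⟩) htX rfl))) ?_
    exact hTmem.2 (inv_mem hW)
  have hexp {X : Op N} (hX : Xᴴ = -X) : exp X ∈ T := by
    -- exp X is the (k+1)-st power of exp(X/(k+1)), which is near 1 for large k.
    have hlim : Tendsto (fun k : ℕ => exp (((k + 1 : ℝ)⁻¹) • X)) atTop (𝓝 1) := by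
      let _ : NormedAlgebra ℚ (Op N) := NormedAlgebra.restrictScalars ℚ ℝ _
      have h1 : Tendsto (fun k : ℕ => ((k + 1 : ℝ)⁻¹) • X) atTop (𝓝 ((0 : ℝ) • X)) := by
        refine Tendsto.smul_const ?_ X
        simpa using tendsto_one_div_add_atTop_nhds_zero_nat (𝕜 := ℝ)
      have h2 := (exp_continuous.tendsto ((0 : ℝ) • X)).comp h1
      rw [zero_smul, exp_zero] at h2
      exact h2
    obtain ⟨k, hk⟩ := (hlim.eventually hnear).exists
    have hpow := pow_mem (hk (exp_mem_unitaryGroup (conjTranspose_real_smul hX _))) (k + 1)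
    rw [← Matrix.exp_nsmul, ← Nat.cast_smul_eq_nsmul ℝ, smul_smul] at hpow
    push_cast at hpow
    rwa [mul_inv_cancel₀ (by positivity), one_smul] at hpow
  refine eq_top_iff.2 fun W _ => hTmem.1 ?_
  obtain ⟨θ, X, hX, hW⟩ := Matrix.exists_phase_smul_eq_exp (W : Op N) W.2
  rw [hW]
  exact T.mul_mem (hexp (mul_I_smul_one_mem_gens (C := C) θ).2) (hexp hX)

end Code
end QEC
end

/-! ### Density of the logical fault-tolerant operators forces the universality condition. -/

section
open NormedSpace Filter Topology

attribute [local instance] Matrix.linftyOpNormedRing Matrix.linftyOpNormedAlgebra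

namespace QEC
variable {n N K : ℕ}

/-- The complex span of a real space of matrices. -/
def complexification (g : Submodule ℝ (Op n)) : Submodule ℂ (Op n) where
  carrier := {Z | ∃ a ∈ g, ∃ b ∈ g, Z = a + Complex.I • b}
  add_mem' := by
    rintro _ _ ⟨a, ha, b, hb, rfl⟩ ⟨a', ha', b', hb', rfl⟩
    exact ⟨a + a', g.add_mem ha ha', b + b', g.add_mem hb hb', by rw [smul_add]; abel⟩
  zero_mem' := ⟨0, g.zero_mem, 0, g.zero_mem, by simp⟩
  smul_mem' := by
    rintro c _ ⟨a, ha, b, hb, rfl⟩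
    refine ⟨c.re • a - c.im • b, g.sub_mem (g.smul_mem _ ha) (g.smul_mem _ hb),
      c.im • a + c.re • b, g.add_mem (g.smul_mem _ ha) (g.smul_mem _ hb), ?_⟩
    ext i j
    simp only [Matrix.smul_apply, Matrix.add_apply, Matrix.sub_apply, smul_eq_mul,
      Complex.real_smul]
    conv_lhs => rw [← Complex.re_add_im c]
    linear_combination (-(c.im : ℂ) * b i j) * (-Complex.I_mul_I)

theorem mem_complexification {g : Submodule ℝ (Op n)} {a : Op n} (ha : a ∈ g) :
    a ∈ complexification g := ⟨a, ha, 0, g.zero_mem, by simp⟩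

theorem commutator_mem_complexification {g : Submodule ℝ (Op n)} {h₁ h₂ : Op n}
    (hh₁ : ∀ X ∈ g, h₁ * X - X * h₁ ∈ g) (hh₂ : ∀ X ∈ g, h₂ * X - X * h₂ ∈ g) {Z : Op n}
    (hZ : Z ∈ complexification g) :
    (h₁ + Complex.I • h₂) * Z - Z * (h₁ + Complex.I • h₂) ∈ complexification g := by
  have key : ∀ {h : Op n}, (∀ X ∈ g, h * X - X * h ∈ g) → h * Z - Z * h ∈ complexification g := by
    intro h hh
    obtain ⟨a, ha, b, hb, rfl⟩ := hZ
    refine ⟨_, hh a ha, _, hh b hb, ?_⟩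
    rw [mul_add, add_mul, mul_smul_comm, smul_mul_assoc, smul_sub]
    abel
  convert (complexification g).add_mem (key hh₁)
    ((complexification g).smul_mem Complex.I (key hh₂)) using 1
  rw [mul_add, add_mul, mul_smul_comm, smul_mul_assoc, smul_sub]
  abel

/-- Every matrix in the complexification of a space of skew-Hermitian matrices which is itself
skew-Hermitian is in the space. -/
theorem mem_of_mem_complexification {g : Submodule ℝ (Op n)} (hg : ∀ X ∈ g, Xᴴ = -X) {Z : Op n}
    (hZ : Z ∈ complexification g) (hskew : Zᴴ = -Z) : Z ∈ g := by
  obtain ⟨a, ha, b, hb, rfl⟩ := hZ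
  -- As Z and a are skew-Hermitian, so is i b; but i b is Hermitian because b is skew-Hermitian.
  have h0 : b = 0 := by
    rw [Matrix.conjTranspose_add, Matrix.conjTranspose_smul, hg a ha, hg b hb] at hskew
    have h2 : (2 * Complex.I) • b = 0 := by
      rw [Complex.star_def, Complex.conj_I, neg_smul, smul_neg, neg_neg, neg_add,
        add_right_inj] at hskew
      rw [mul_smul, two_smul]
      nth_rewrite 1 [hskew]
      simp
    exact (smul_eq_zero.1 h2).resolve_left (by simp)
  simpa [h0] using ha

namespace Code

variable {C : Code N K}

theorem proj_mul_proj : C.proj * C.proj = C.proj := by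
  have (M : Matrix (Fin K) (Fin N) ℂ) : C.encᴴ * (C.enc * M) = M := by
    rw [← Matrix.mul_assoc, C.isometry, Matrix.one_mul]
  simp only [proj, Matrix.mul_assoc, this]

theorem conjTranspose_proj : C.projᴴ = C.proj := by
  simp [proj]

theorem proj_mul_enc : C.proj * C.enc = C.enc := by
  rw [proj, Matrix.mul_assoc, C.isometry, Matrix.mul_one]

theorem errorAlgebra_le_physicalAlgebra : C.errorAlgebra ≤ physicalAlgebra N :=
  LieSubalgebra.lieSpan_le.2 fun _ hX => hX.2

theorem exp_conj_mem_errorAlgebra {X Y : Op N} (hX : X ∈ C.gens) (hY : Y ∈ C.errorAlgebra) :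
    exp X * Y * (exp X)ᴴ ∈ C.errorAlgebra := by
  have hneg : exp (-X) = (exp X)ᴴ := by
    rw [← mem_physicalAlgebra.1 hX.2, Matrix.exp_conjTranspose]
  have h := Submodule.exp_mul_mul_exp_neg_mem (S := C.errorAlgebra.toSubmodule)
    (isClosed_submodule _) (h := X)
    (fun Z hZ => C.errorAlgebra.lie_mem (LieSubalgebra.subset_lieSpan hX) hZ) hY
  exact hneg ▸ h

theorem faultTolerant_conj_mem_errorAlgebra {W : U N} (hW : W ∈ C.faultTolerant) :
    ∀ Y ∈ C.errorAlgebra, (W : Op N) * Y * (W : Op N)ᴴ ∈ C.errorAlgebra := by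
  obtain ⟨Φ, hΦ⟩ := hW
  induction hΦ with
  | nil =>
    intro Y hY
    rwa [OneMemClass.coe_one, Matrix.conjTranspose_one, mul_one, one_mul]
  | step W Φ F X EC _ hX hF _ ih =>
    intro Y hY
    have h := exp_conj_mem_errorAlgebra hX (ih Y hY)
    have heq : ((F * W : U N) : Op N) * Y * ((F * W : U N) : Op N)ᴴ
        = (F : Op N) * ((W : Op N) * Y * (W : Op N)ᴴ) * (F : Op N)ᴴ := by
      rw [Submonoid.coe_mul, Matrix.conjTranspose_mul]
      simp only [mul_assoc]
    rw [heq, hF]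
    exact h

/-- Conjugation invariance is a closed condition on W, since a finite-dimensional subspace is
closed, so it passes from the dense subset to all logical operators. -/
theorem logical_conj_mem_errorAlgebra (hC : C.FTUniversal) {W : U N} (hW : W ∈ C.logical)
    {Y : Op N} (hY : Y ∈ C.errorAlgebra) :
    (W : Op N) * Y * (W : Op N)ᴴ ∈ C.errorAlgebra := by
  have hcont : Continuous fun W : U N => (W : Op N) * Y * (W : Op N)ᴴ := by
    have h : Continuous fun W : U N => (W : Op N) := continuous_subtype_val
    exact (h.matrix_mul continuous_const).matrix_mul h.matrix_conjTranspose
  have hclosed := (isClosed_submodule C.errorAlgebra.toSubmodule).preimage hcont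
  exact closure_minimal (fun W hW => faultTolerant_conj_mem_errorAlgebra hW.1 Y hY) hclosed (hC hW)

/-- If the logical fault-tolerant operators are universal, then the error algebra is stable under
commutators with the skew-Hermitian generators of logical operators. -/
theorem commutator_mem_errorAlgebra (hC : C.FTUniversal) {H : Op N} (hH : Hᴴ = -H)
    (hHP : H * C.proj = C.proj * H) {Y : Op N} (hY : Y ∈ C.errorAlgebra) :
    H * Y - Y * H ∈ C.errorAlgebra := by
  refine Submodule.mul_sub_mul_mem_of_exp (S := C.errorAlgebra.toSubmodule)
    (isClosed_submodule _) fun t => ?_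
  have hskew := conjTranspose_real_smul hH t
  have hneg : exp (-(t • H)) = (exp (t • H))ᴴ := by
    rw [← hskew, Matrix.exp_conjTranspose]
  have hcomm : exp (t • H) * C.proj = C.proj * exp (t • H) := by
    let _ : NormedAlgebra ℚ (Op N) := NormedAlgebra.restrictScalars ℚ ℝ _
    have : Commute C.proj (t • H) := Commute.smul_right hHP.symm t
    exact this.exp_right.symm
  have hlog : (⟨exp (t • H), exp_mem_unitaryGroup hskew⟩ : U N) ∈ C.logical := by
    change C.proj * exp (t • H) * C.proj = exp (t • H) * C.proj
    rw [mul_assoc, hcomm, ← mul_assoc, proj_mul_proj]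
  have h := logical_conj_mem_errorAlgebra hC hlog hY
  exact hneg ▸ h

/-- H is H₁ + i H₂ with both parts skew-Hermitian; they commute with the projection because Hᴴ does.
-/
theorem commutator_mem_complexification_errorAlgebra (hC : C.FTUniversal) {H : Op N}
    (hHP : H * C.proj = C.proj * H) {Z : Op N}
    (hZ : Z ∈ complexification C.errorAlgebra.toSubmodule) :
    H * Z - Z * H ∈ complexification C.errorAlgebra.toSubmodule := by
  have hHP' : Hᴴ * C.proj = C.proj * Hᴴ := by
    have := congrArg Matrix.conjTranspose hHP
    rw [Matrix.conjTranspose_mul, Matrix.conjTranspose_mul, conjTranspose_proj] at this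
    exact this.symm
  have hsplit : H = (2⁻¹ : ℂ) • (H - Hᴴ) + Complex.I • ((-(Complex.I * 2⁻¹)) • (H + Hᴴ)) := by
    rw [smul_smul, mul_neg, ← mul_assoc, Complex.I_mul_I, neg_mul, one_mul, neg_neg]
    module
  rw [hsplit]
  refine commutator_mem_complexification
    (fun X hX => commutator_mem_errorAlgebra hC ?_ ?_ hX)
    (fun X hX => commutator_mem_errorAlgebra hC ?_ ?_ hX) hZ
  · rw [Matrix.conjTranspose_smul, Matrix.conjTranspose_sub, Matrix.conjTranspose_conjTranspose,
      ← smul_neg, neg_sub]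
    simp
  · rw [smul_mul_assoc, mul_smul_comm, sub_mul, mul_sub, hHP, hHP']
  · rw [Matrix.conjTranspose_smul, Matrix.conjTranspose_add, Matrix.conjTranspose_conjTranspose,
      add_comm Hᴴ, ← neg_smul]
    simp
  · rw [smul_mul_assoc, mul_smul_comm, add_mul, mul_add, hHP, hHP']

/-- If universality holds and some error leaks out of the code space, then the error algebra is the
whole physical algebra. -/
theorem universalityCondition_of_leak (hC : C.FTUniversal) {X : Op N} (hX : X ∈ C.gens)
    (hne : C.proj * X * (1 - C.proj) ≠ 0) : C.UniversalityCondition := by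
  set P := C.proj with hP
  set D := complexification C.errorAlgebra.toSubmodule with hD
  have hgens {X : Op N} (hX : X ∈ C.gens) : X ∈ D :=
    mem_complexification (LieSubalgebra.subset_lieSpan hX)
  have hinv : ∀ H, H * P = P * H → ∀ Z ∈ D, H * Z - Z * H ∈ D := fun H hH Z hZ =>
    commutator_mem_complexification_errorAlgebra hC hH hZ
  -- For skew-Hermitian X the two off-diagonal corners are adjoint up to sign, so one is nonzero
  -- exactly when the other is.
  have hne' : (1 - P) * X * P ≠ 0 := by
    intro h0
    refine hne ?_
    have := congrArg Matrix.conjTranspose h0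
    rw [Matrix.conjTranspose_mul, Matrix.conjTranspose_mul, Matrix.conjTranspose_sub,
      Matrix.conjTranspose_one, hP, conjTranspose_proj, mem_physicalAlgebra.1 hX.2,
      Matrix.conjTranspose_zero, neg_mul, mul_neg, neg_eq_zero, ← mul_assoc] at this
    exact this
  have hQQ : (1 - P) * (1 - P) = 1 - P := by
    simp only [mul_sub, sub_mul, hP, proj_mul_proj, mul_one, one_mul]
    abel
  have hP0 : P ≠ 0 := by
    intro h0
    rw [h0] at hne
    simp at hne
  have hQ0 : 1 - P ≠ 0 := by
    intro h0
    rw [h0] at hne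
    simp at hne
  have htop : D = ⊤ := by
    refine eq_top_of_corners proj_mul_proj (add_sub_cancel _ _) hP0 hQ0 ?_ ?_
      (corner_mem proj_mul_proj (add_sub_cancel _ _) hinv (hgens hX) hne)
      (corner_mem hQQ (sub_add_cancel _ _) (fun H hH => hinv H ?_) (hgens hX) hne')
    · have := D.smul_mem (-Complex.I) (hgens (mul_I_smul_one_mem_gens (C := C) 1))
      rw [smul_smul] at this
      simpa using this
    · intro Y hY Z hZ
      obtain ⟨a, ha, b, hb, rfl⟩ := hY
      exact commutator_mem_complexification (fun X hX => C.errorAlgebra.lie_mem ha hX)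
        (fun X hX => C.errorAlgebra.lie_mem hb hX) hZ
    · rw [mul_sub, sub_mul, mul_one, one_mul] at hH
      exact sub_right_injective hH
  refine le_antisymm errorAlgebra_le_physicalAlgebra fun Z hZ => ?_
  have hZD : Z ∈ D := htop ▸ Submodule.mem_top
  exact mem_of_mem_complexification (g := C.errorAlgebra.toSubmodule)
    (fun X hX => errorAlgebra_le_physicalAlgebra hX) hZD hZ

/-- If no error leaks out of the code space, then fault-tolerant operators act on the code
space as scalars. -/
theorem exists_faultTolerant_mul_proj (hK : 0 < K)
    (h0 : ∀ X ∈ C.gens, C.proj * X * (1 - C.proj) = 0) {W : U N} (hW : W ∈ C.faultTolerant) :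
    ∃ c : ℂ, (W : Op N) * C.proj = c • C.proj := by
  refine faultTolerant_induction (p := fun W => ∃ c : ℂ, (W : Op N) * C.proj = c • C.proj)
    ⟨1, by simp⟩ ?_ hW
  rintro W F X - hX hF ⟨c, hc⟩
  have hleak : (1 - C.proj) * X * C.proj = 0 := by
    have := congrArg Matrix.conjTranspose (h0 X hX)
    rw [Matrix.conjTranspose_mul, Matrix.conjTranspose_mul, Matrix.conjTranspose_sub,
      Matrix.conjTranspose_one, conjTranspose_proj, mem_physicalAlgebra.1 hX.2,
      Matrix.conjTranspose_zero, neg_mul, mul_neg, neg_eq_zero, ← mul_assoc] at this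
    exact this
  obtain ⟨d, hd⟩ := C.exists_enc_conj_eq_smul hK hX.1
  -- Without leakage XP = PXP, which Knill–Laflamme makes a scalar multiple of P; hence exp(X) P =
  -- exp(d) P.
  have hXP : X * C.proj = d • C.proj := by
    rw [sub_mul, sub_mul, one_mul, sub_eq_zero] at hleak
    rw [hleak]
    calc C.proj * X * C.proj = C.enc * (C.encᴴ * X * C.enc) * C.encᴴ := by
          simp only [proj, Matrix.mul_assoc]
      _ = d • C.proj := by
          rw [hd, Matrix.mul_smul, Matrix.mul_one, Matrix.smul_mul, proj]
  have hpow (k : ℕ) : X ^ k * C.proj = d ^ k • C.proj := by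
    induction k with
    | zero => simp
    | succ k ih => rw [pow_succ, mul_assoc, hXP, mul_smul_comm, ih, smul_smul, pow_succ']
  have hFP : (F : Op N) * C.proj = exp d • C.proj := by
    have h1 := (exp_series_hasSum_exp' (𝕂 := ℂ) X).mul_right C.proj
    have h2 := (exp_series_hasSum_exp' (𝕂 := ℂ) d).smul_const C.proj
    simp only [smul_mul_assoc, hpow] at h1
    simp only [smul_assoc] at h2
    rw [hF]
    exact h1.unique h2
  refine ⟨c * exp d, ?_⟩
  rw [Submonoid.coe_mul, mul_assoc, hc, mul_smul_comm, hFP, smul_smul]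

/-- A logical reflection which is not a scalar on a code space of dimension at least two. -/
theorem exists_logical_not_scalar (hK : 2 ≤ K) (C : Code N K) :
    ∃ W ∈ C.logical, (C.encᴴ * (W : Op N) * C.enc) ⟨0, by omega⟩ ⟨0, by omega⟩ ≠
      (C.encᴴ * (W : Op N) * C.enc) ⟨1, by omega⟩ ⟨1, by omega⟩ := by
  set e : Op K := Matrix.single ⟨0, by omega⟩ ⟨0, by omega⟩ 1 with he
  -- The reflection 1 - 2p in the first encoded basis vector has logical diagonal entries -1 and 1
  -- at the first two places.
  set p : Op N := C.enc * e * C.encᴴ with hp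
  have hee : e * e = e := by simp [he]
  have heh : eᴴ = e := by simp [he]
  have hph : pᴴ = p := by
    simp only [hp, Matrix.conjTranspose_mul, heh, Matrix.conjTranspose_conjTranspose,
      Matrix.mul_assoc]
  have hV {m : ℕ} (M : Matrix (Fin K) (Fin m) ℂ) : C.encᴴ * (C.enc * M) = M := by
    rw [← Matrix.mul_assoc, C.isometry, Matrix.one_mul]
  have hpp : p * p = p := by
    calc p * p = C.enc * (e * e) * C.encᴴ := by simp only [hp, Matrix.mul_assoc, hV]
      _ = p := by rw [hee]
  have hPp : C.proj * p = p := by simp only [hp, proj, Matrix.mul_assoc, hV]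
  have hW : 1 - (2 : ℂ) • p ∈ Matrix.unitaryGroup (Fin N) ℂ := by
    rw [Matrix.mem_unitaryGroup_iff, Matrix.star_eq_conjTranspose, Matrix.conjTranspose_sub,
      Matrix.conjTranspose_smul, hph, Matrix.conjTranspose_one]
    simp only [star_ofNat, mul_sub, sub_mul, mul_one, one_mul, smul_mul_smul_comm, hpp]
    module
  refine ⟨⟨_, hW⟩, ?_, ?_⟩
  · change C.proj * (1 - (2 : ℂ) • p) * C.proj = (1 - (2 : ℂ) • p) * C.proj
    rw [mul_sub, mul_one, mul_smul_comm, hPp, sub_mul, sub_mul, proj_mul_proj, one_mul]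
  · have hval : C.encᴴ * (1 - (2 : ℂ) • p) * C.enc = 1 - (2 : ℂ) • e := by
      rw [Matrix.mul_sub, Matrix.sub_mul, Matrix.mul_one, C.isometry, Matrix.mul_smul,
        Matrix.smul_mul]
      simp only [hp, Matrix.mul_assoc, hV, C.isometry, Matrix.mul_one]
    dsimp only
    rw [hval]
    simp [he]

/-- Without leakage, all logical fault-tolerant operators have equal first two diagonal entries on
the code space. This is a closed condition, which the reflection violates. -/
theorem universalityCondition_of_ftUniversal (hK : 2 ≤ K) (hC : C.FTUniversal) :
    C.UniversalityCondition := by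
  by_cases hleak : ∃ X ∈ C.gens, C.proj * X * (1 - C.proj) ≠ 0
  · obtain ⟨X, hX, hne⟩ := hleak
    exact universalityCondition_of_leak hC hX hne
  push Not at hleak
  exfalso
  obtain ⟨W, hW, hne⟩ := C.exists_logical_not_scalar hK
  refine hne ?_
  have hcont (i : Fin K) : Continuous fun W : U N => (C.encᴴ * (W : Op N) * C.enc) i i := by
    have h : Continuous fun W : U N => (W : Op N) := continuous_subtype_val
    exact ((continuous_const.matrix_mul h).matrix_mul continuous_const).matrix_elem i i
  refine closure_minimal (fun W hW => ?_) (isClosed_eq (hcont _) (hcont _)) (hC hW)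
  obtain ⟨c, hc⟩ := exists_faultTolerant_mul_proj (by omega) hleak hW.1
  have : C.encᴴ * (W : Op N) * C.enc = c • (1 : Op K) := by
    calc C.encᴴ * (W : Op N) * C.enc = C.encᴴ * ((W : Op N) * C.proj) * C.enc := by
          rw [Matrix.mul_assoc, Matrix.mul_assoc, Matrix.mul_assoc, proj_mul_enc]
      _ = c • (1 : Op K) := by
          rw [hc, Matrix.mul_smul, Matrix.smul_mul, Matrix.mul_assoc, proj_mul_enc, C.isometry]
  change (C.encᴴ * (W : Op N) * C.enc) _ _ = (C.encᴴ * (W : Op N) * C.enc) _ _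
  simp [this]

theorem ftUniversal_of_universalityCondition (hC : C.UniversalityCondition) : C.FTUniversal := by
  refine fun W hW => subset_closure ⟨?_, hW⟩
  have : W ∈ C.faultTolerantGroup := faultTolerantGroup_eq_top hC ▸ Subgroup.mem_top W
  exact this

end Code
end QEC
end

end

theorem theorem1 {N K : ℕ} (hK : 2 ≤ K) (C : QEC.Code N K) :
    C.FTUniversal ↔ C.UniversalityCondition :=
  ⟨QEC.Code.universalityCondition_of_ftUniversal hK,
    QEC.Code.ftUniversal_of_universalityCondition⟩
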